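/- Let $\mathcal G=(V,\mathcal R,\Sigma,T)$ be a context-free grammar in Chomsky normal form (finite sets $V$ of variables and $\Sigma$ of terminals; every rule is $A\to BC$ with $B,C\in V\setminus\{T\}$, or $A\to a$ with $a\in\Sigma$, or $T\to\epsilon$), let $\mathcal R_B$ be the set of its binary rules $A\to BC$, and let $\Gamma$ be the number of distinct right-hand sides in $\mathcal R_B$. Let $w$ be a string of length $n$ over $\Sigma$. The CYK algorithm, which computes for all $1\le i\le j\le n$ the set $S(i,j)$ of variables deriving $w_i\cdots w_j$, is represented by a computational directed acyclic graph (CDAG) $G_{CYK}$ each of whose vertices is a value stored in one memory word. For every $1\le i\le j\le n$ and $A\in V$ there is a variable-root vertex $v^A_{i,j}$. For $i<j$, if $A$ is the left-hand side of some binary rule, $v^A_{i,j}$ is the root of a binary tree whose leaves are grammar-root vertices, one for each binary rule with left-hand side $A$; the grammar root for $S(i,j)$ and a rule $A\to XY$ is in turn the root of a binary tree with $j-i$ leaves, one for each $i\le k<j$, and the $k$-th leaf has the predecessors $v^X_{i,k}$ and $v^Y_{k+1,j}$. All other variable roots have no predecessors. The shapes of the binary trees (every vertex has at most two children) are arbitrary.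 The CDAG is evaluated on a machine with a cache of $M\ge 1$ words and an unlimited slow memory. Initially the cache is empty and the slow memory holds exactly the inputs (the vertices without predecessors). A vertex can be evaluated only when all its operands are in the cache, and one I/O operation (a read or a write) moves up to $B\ge 1$ words between consecutive locations of the cache and of the slow memory. In a schedule every input is loaded into the cache, and every other vertex is evaluated, at least once; recomputation is allowed. Then, for every shape of the trees, every schedule executes at least $$\max\left\{\frac{(n-6M-1)^3}{18\sqrt M}\,\Gamma-2M\Gamma,\; n\right\}\frac1B$$ I/O operations. Hence there are absolute constants $c,K>0$ such that for $M\le cn$ every schedule executes at least $K\,\dfrac{n^3\Gamma}{\sqrt M\,B}$ I/O operations, that is, $\Omega\left(\dfrac{n^3\Gamma}{\sqrt M\,B}\right)$. -/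

import Mathlib

/-! ### Grammars in Chomsky normal form -/

/-- A context-free grammar is in Chomsky normal form if every rule has the form `A → B C` with
`B`, `C` variables other than the start variable, or `A → a` with `a` a terminal, or `T → ε` with
`T` the start variable. -/
def IsCNF {α : Type*} (g : ContextFreeGrammar α) : Prop :=
  ∀ r ∈ g.rules,
    (∃ X Y : g.NT, X ≠ g.initial ∧ Y ≠ g.initial ∧
      r.output = [Symbol.nonterminal X, Symbol.nonterminal Y]) ∨
    (∃ a : α, r.output = [Symbol.terminal a]) ∨
    (r.input = g.initial ∧ r.output = [])

/-- A binary rule `lhs → fst snd` over a set `N` of variables. -/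
structure BinaryRule (N : Type*) where
  lhs : N
  fst : N
  snd : N

/-- The set `R_B` of the binary rules of a grammar. -/
def binaryRules {α : Type*} (g : ContextFreeGrammar α) : Set (BinaryRule g.NT) :=
  {r | (⟨r.lhs, [Symbol.nonterminal r.fst, Symbol.nonterminal r.snd]⟩ :
      ContextFreeRule α g.NT) ∈ g.rules}

/-- The binary rules of a grammar with left-hand side `A`. -/
def rulesFor {α : Type*} (g : ContextFreeGrammar α) (A : g.NT) : Set (BinaryRule g.NT) :=
  {r | r ∈ binaryRules g ∧ r.lhs = A}

/-- `Γ`: the number of distinct right-hand sides of the binary rules. -/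
noncomputable def numRHS {α : Type*} (g : ContextFreeGrammar α) : ℕ :=
  ((fun r : BinaryRule g.NT => (r.fst, r.snd)) '' binaryRules g).ncard

/-! ### Binary trees -/

/-- Rooted binary trees (every vertex has at most two children) with labelled leaves. -/
inductive BTree (β : Type*) where
  | leaf (b : β) : BTree β
  | unary (t : BTree β) : BTree β
  | binary (l r : BTree β) : BTree β

/-- The labels of the leaves, from left to right. -/
def BTree.leaves {β : Type*} : BTree β → List β
  | .leaf b => [b]
  | .unary t => t.leaves
  | .binary l r => l.leaves ++ r.leaves

/-- The leaves of `t` are in bijection, through their labels, with the elements of `S`. -/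
def BTree.HasLeafSet {β : Type*} (t : BTree β) (S : Set β) : Prop :=
  t.leaves.Nodup ∧ ∀ b, b ∈ t.leaves ↔ b ∈ S

/-- The vertices of a tree are addressed by paths from the root (`false`: the only or the left
child, `true`: the right child). `t.subtree p` is the subtree whose root is the vertex at `p`, and
`none` if there is no such vertex. -/
def BTree.subtree {β : Type*} : BTree β → List Bool → Option (BTree β)
  | t, [] => some t
  | .leaf _, _ :: _ => none
  | .unary t, false :: p => t.subtree p
  | .unary _, true :: _ => none
  | .binary l _, false :: p => l.subtree p
  | .binary _ r, true :: p => r.subtree p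

/-! ### Computational directed acyclic graphs and the two-level memory machine -/

/-- A directed graph on a set `verts` of vertices, given by the predecessors (operands) of each
vertex. -/
structure CDAG (W : Type*) where
  verts : Set W
  pred : W → Set W

/-- The input vertices: those without predecessors. -/
def CDAG.inputs {W : Type*} (G : CDAG W) : Set W :=
  {v | v ∈ G.verts ∧ G.pred v = ∅}

/-- The contents of a cache of `M` words and of a slow memory of unlimited size. A word is empty
or holds the value of one vertex. -/
structure Config (W : Type*) (M : ℕ) where
  cache : Fin M → Option W
  mem : ℕ → Option W

/-- One step of the machine. The first index is its cost in I/O operations: `1` for a read or a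
write, `0` for all other steps. -/
inductive Step {W : Type*} (G : CDAG W) (M B : ℕ) : ℕ → Config W M → Config W M → Prop
  /-- Evaluate a vertex that is not an input, all of whose operands are in the cache; the result
  goes to an arbitrary word of the cache (which may be that of an operand). -/
  | compute (c : Config W M) (v : W) (hv : v ∈ G.verts) (hne : (G.pred v).Nonempty)
      (hop : ∀ u ∈ G.pred v, ∃ x, c.cache x = some u) (y : Fin M) :
      Step G M B 0 c ⟨Function.update c.cache y (some v), c.mem⟩
  /-- Copy a word within the cache. -/
  | move (c : Config W M) (x y : Fin M) :
      Step G M B 0 c ⟨Function.update c.cache y (c.cache x), c.mem⟩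
  /-- Copy `len ≤ B` consecutive words of the slow memory, from address `a` on, to consecutive
  words of the cache, from address `s` on. -/
  | read (c : Config W M) (a s len : ℕ) (hB : len ≤ B) (hs : s + len ≤ M) :
      Step G M B 1 c
        ⟨fun x => if s ≤ x.val ∧ x.val < s + len then c.mem (a + (x.val - s)) else c.cache x,
          c.mem⟩
  /-- Copy `len ≤ B` consecutive words of the cache, from address `s` on, to consecutive words of
  the slow memory, from address `a` on. -/
  | write (c : Config W M) (a s len : ℕ) (hB : len ≤ B) (hs : s + len ≤ M) :
      Step G M B 1 c
        ⟨c.cache, fun y =>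
          if h : a ≤ y ∧ y < a + len then c.cache ⟨s + (y - a), by omega⟩ else c.mem y⟩

/-- A computational schedule evaluating `G` on a machine with a cache of `M` words whose I/O
operations move up to `B` words: a finite sequence of steps that starts with an empty cache and
with exactly the inputs of `G` in the slow memory (at any addresses), and in which every vertex is
in the cache at some time, so that every input is loaded and every other vertex is evaluated at
least once. Values may be evaluated any number of times. -/
structure Schedule {W : Type*} (G : CDAG W) (M B : ℕ) where
  length : ℕ
  conf : ℕ → Config W M
  cost : ℕ → ℕ
  cache_init : ∀ x, (conf 0).cache x = none
  mem_init : ∀ v, (∃ a, (conf 0).mem a = some v) ↔ v ∈ G.inputs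
  step : ∀ t < length, Step G M B (cost t) (conf t) (conf (t + 1))
  complete : ∀ v ∈ G.verts, ∃ t ≤ length, ∃ x, (conf t).cache x = some v

/-- The number of I/O operations of a schedule. -/
def Schedule.ioCount {W : Type*} {G : CDAG W} {M B : ℕ} (C : Schedule G M B) : ℕ :=
  ∑ t ∈ Finset.range C.length, C.cost t

/-! ### The CDAG of the Cocke–Younger–Kasami algorithm -/

/-- A choice of the trees by which results are aggregated, for inputs of length `n`: for every
subproblem `S(i, j)` with `i < j`,
* for every binary rule, a tree with one leaf for every `k` with `i ≤ k < j`, which corresponds to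
  the combination of `S(i, k)` and `S(k + 1, j)`;
* for every variable `A` that is the left-hand side of a binary rule, a tree with one leaf for
  every binary rule with left-hand side `A`. -/
structure CYKTrees {α : Type*} (g : ContextFreeGrammar α) (n : ℕ) where
  ruleTree : ℕ → ℕ → BinaryRule g.NT → BTree ℕ
  varTree : ℕ → ℕ → g.NT → BTree (BinaryRule g.NT)
  ruleTree_leaves : ∀ i j, 1 ≤ i → i < j → j ≤ n → ∀ r ∈ binaryRules g,
    (ruleTree i j r).HasLeafSet (Set.Ico i j)
  varTree_leaves : ∀ i j, 1 ≤ i → i < j → j ≤ n → ∀ A, (rulesFor g A).Nonempty →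
    (varTree i j A).HasLeafSet (rulesFor g A)

/-- The vertices of the CDAG. -/
inductive CYKVertex (N : Type*) where
  /-- The variable root of `S(i, j)` and `A`, if it is not the result of an operation. -/
  | source (i j : ℕ) (A : N) : CYKVertex N
  /-- The vertex at `p`, not a leaf, of the tree of `S(i, j)` and the variable `A`. -/
  | varNode (i j : ℕ) (A : N) (p : List Bool) : CYKVertex N
  /-- The vertex at `p` of the tree of `S(i, j)` and the rule `r`. -/
  | ruleNode (i j : ℕ) (r : BinaryRule N) (p : List Bool) : CYKVertex N

namespace CYKTrees

variable {α : Type*} {g : ContextFreeGrammar α} {n : ℕ}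

/-- The grammar root of `S(i, j)` and the rule `r`: the root of the tree of the rule. -/
def grammarRoot (_τ : CYKTrees g n) (i j : ℕ) (r : BinaryRule g.NT) : CYKVertex g.NT :=
  .ruleNode i j r []

/-- The vertex at `p` of the tree of `S(i, j)` and `A`. Its leaves are the grammar roots of the
rules with left-hand side `A`. -/
def varVertex (τ : CYKTrees g n) (i j : ℕ) (A : g.NT) (p : List Bool) : CYKVertex g.NT :=
  match (τ.varTree i j A).subtree p with
  | some (.leaf r) => τ.grammarRoot i j r
  | _ => .varNode i j A p

open Classical in
/-- The variable root of `S(i, j)` and `A`: the root of the tree of `S(i, j)` and `A`, or, if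
`i = j` or no binary rule has the left-hand side `A`, a vertex without predecessors. -/
noncomputable def varRoot (τ : CYKTrees g n) (i j : ℕ) (A : g.NT) : CYKVertex g.NT :=
  if i < j ∧ (rulesFor g A).Nonempty then τ.varVertex i j A [] else .source i j A

/-- The vertices that occur in the CDAG. -/
def IsVertex (τ : CYKTrees g n) : CYKVertex g.NT → Prop
  | .source i j A => 1 ≤ i ∧ i ≤ j ∧ j ≤ n ∧ (i = j ∨ ¬ (rulesFor g A).Nonempty)
  | .varNode i j A p => 1 ≤ i ∧ i < j ∧ j ≤ n ∧ (rulesFor g A).Nonempty ∧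
      ∃ t, (τ.varTree i j A).subtree p = some t ∧ ∀ r, t ≠ .leaf r
  | .ruleNode i j r p => 1 ≤ i ∧ i < j ∧ j ≤ n ∧ r ∈ binaryRules g ∧
      ∃ t, (τ.ruleTree i j r).subtree p = some t

/-- The predecessors of a vertex: its children in its tree, and, for the leaf with label `k` of
the tree of `S(i, j)` and a rule `A → X Y`, the variable root of `S(i, k)` and `X` and the variable
root of `S(k + 1, j)` and `Y`. -/
def preds (τ : CYKTrees g n) : CYKVertex g.NT → Set (CYKVertex g.NT)
  | .source _ _ _ => ∅
  | .varNode i j A p =>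
      match (τ.varTree i j A).subtree p with
      | some (.unary _) => {τ.varVertex i j A (p ++ [false])}
      | some (.binary _ _) =>
          {τ.varVertex i j A (p ++ [false]), τ.varVertex i j A (p ++ [true])}
      | _ => ∅
  | .ruleNode i j r p =>
      match (τ.ruleTree i j r).subtree p with
      | some (.leaf k) => {τ.varRoot i k r.fst, τ.varRoot (k + 1) j r.snd}
      | some (.unary _) => {.ruleNode i j r (p ++ [false])}
      | some (.binary _ _) => {.ruleNode i j r (p ++ [false]), .ruleNode i j r (p ++ [true])}
      | none => ∅

/-- The CDAG of the CYK algorithm for the grammar `g`, inputs of length `n`, and the given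
aggregation trees. -/
def cdag (τ : CYKTrees g n) : CDAG (CYKVertex g.NT) where
  verts := {v | τ.IsVertex v}
  pred := τ.preds

end CYKTrees

/-! ### Schedules that move one word at a time -/

/-! An I/O operation of width `B` splits into `B` operations of width 1, so it suffices to show that
a machine of width 1 moves at least `max {…}` words. Addresses are irrelevant: only the sets of
values in cache and slow memory matter (`Trace`). The time axis is cut into `h` segments with at
most `M` I/O operations each (`exists_segments`). Then at most `2 * M` values are available in a
segment without evaluation (`avail`) and at most `2 * M` survive it through the cache or through
writes (`kept`).

Let `d` be the number of leaves of a rule tree that are charged to a given segment. Two facts limit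
these numbers, even with recomputation.

Squares: a leaf `k` of `S(i, j)` and `A → X Y` needs the variable roots of `S(i, k)`, `X` and `S(k +
1, j)`, `Y`. If both subproblems are large, their trees must each contain an available value
(`mem_touched_of_card_le`), because recomputing such a root from outside its tree would need
available values for more than `2 * M` right ends. So the operands come from at most `2 * M` trees,
and counting pairs of operands gives `∑ d ^ 2 ≤ (2 * M) ^ 2` (`sum_card_sq_le`).

Trees: each leaf is charged to an evaluation that a fixed evaluation of the root of its tree depends
on. Either this root is evaluated in the same segment, or a value of the tree survives the segment
(`exists_useful_cmp`). So all but `2 * M` of the trees met in a segment have their root assigned to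
it.

With `d ≤ d ^ 2 / (4 * √M) + √M` these give at most `h * 3 * M * √M + √M * |T|` leaves over a set
`T` of trees (`sum_card_le_of_segments`). Comparing with the cubic number of leaves bounds `h`,
hence the I/O, from below. The term `n` holds because the `n` inputs on the diagonal must each be
read. -/

theorem Step.exists_refinement {W : Type*} {G : CDAG W} {M B : ℕ} (hB : 1 ≤ B) {k : ℕ}
    {c d : Config W M} (h : Step G M B k c d) :
    ∃ I : ℕ → Config W M, I 0 = c ∧ I B = d ∧ ∀ l < B, Step G M 1 k (I l) (I (l + 1)) := by
  have idle : ∀ (e : Config W M) (y : Fin M), Step G M 1 0 e e := fun e y => by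
    simpa using Step.move (G := G) (B := 1) e y y
  cases h with
  | compute _ v hv hne hop y =>
    refine ⟨fun l => if l = 0 then c else ⟨Function.update c.cache y (some v), c.mem⟩,
      by simp, by simp; omega, fun l _ => ?_⟩
    by_cases hl : l = 0
    · simpa [hl] using Step.compute c v hv hne hop y
    · simpa [hl] using idle _ y
  | move _ x y =>
    refine ⟨fun l => if l = 0 then c else ⟨Function.update c.cache y (c.cache x), c.mem⟩,
      by simp, by simp; omega, fun l _ => ?_⟩
    by_cases hl : l = 0
    · simpa [hl] using Step.move c x y
    · simpa [hl] using idle _ y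
  | read _ a s len hlen hs =>
    obtain ⟨I, hI⟩ : ∃ I : ℕ → Config W M, ∀ l, I l = ⟨fun x =>
        if s ≤ x.val ∧ x.val < s + min l len then c.mem (a + (x.val - s)) else c.cache x,
        c.mem⟩ := ⟨_, fun _ => rfl⟩
    refine ⟨I, ?_, ?_, fun l _ => ?_⟩
    · have : ∀ x : Fin M, ¬ (s ≤ x.val ∧ x.val < s + min 0 len) := fun x => by omega
      simp only [hI, this, if_false]
    · rw [hI, min_eq_right hlen]
    · by_cases hl : l < len
      · convert Step.read (G := G) (B := 1) (I l) (a + l) (s + l) 1 le_rfl (by omega) using 1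
        simp only [hI, Config.mk.injEq, and_true]
        funext x
        have e1 : min (l + 1) len = l + 1 := by omega
        have e2 : min l len = l := by omega
        simp only [e1, e2]
        by_cases hx : x.val = s + l
        · rw [if_pos (by omega), if_pos (by omega)]
          congr 1; omega
        · by_cases hx' : s ≤ x.val ∧ x.val < s + l
          · rw [if_pos (by omega), if_neg (by omega), if_pos (by omega)]
          · rw [if_neg (by omega), if_neg (by omega), if_neg (by omega)]
      -- Padding by empty reads: they move nothing but cost 1, so that all `B` substeps have the
      -- same cost as the original step. Writes are padded likewise.
      · convert Step.read (G := G) (B := 1) (I l) a 0 0 (by omega) (by omega) using 1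
        have e1 : min (l + 1) len = len := by omega
        have e2 : min l len = len := by omega
        simp only [hI, e1, e2, Config.mk.injEq, and_true]
        funext x
        rw [if_neg (c := 0 ≤ x.val ∧ x.val < 0 + 0) (by omega)]
  | write _ a s len hlen hs =>
    obtain ⟨I, hI⟩ : ∃ I : ℕ → Config W M, ∀ l, I l = ⟨c.cache, fun y =>
        if h : a ≤ y ∧ y < a + min l len then c.cache ⟨s + (y - a), by omega⟩ else c.mem y⟩ :=
      ⟨_, fun _ => rfl⟩
    refine ⟨I, ?_, ?_, fun l _ => ?_⟩
    · have : ∀ y : ℕ, ¬ (a ≤ y ∧ y < a + min 0 len) := fun y => by omega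
      simp only [hI, this, dif_neg, not_false_eq_true]
    · rw [hI, Config.mk.injEq]
      simp only [min_eq_right hlen, true_and]
    · by_cases hl : l < len
      · convert Step.write (G := G) (B := 1) (I l) (a + l) (s + l) 1 le_rfl (by omega) using 1
        simp only [hI, Config.mk.injEq, true_and]
        funext y
        by_cases hy : y = a + l
        · rw [dif_pos (by omega), dif_pos (by omega)]
          congr 2; omega
        · by_cases hy' : a ≤ y ∧ y < a + l
          · rw [dif_pos (by omega), dif_neg (by omega), dif_pos (by omega)]
          · rw [dif_neg (by omega), dif_neg (by omega), dif_neg (by omega)]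
      · convert Step.write (G := G) (B := 1) (I l) a 0 0 (by omega) (by omega) using 1
        have e1 : min (l + 1) len = len := by omega
        have e2 : min l len = len := by omega
        simp only [hI, e1, e2, Config.mk.injEq, true_and]
        funext y
        rw [dif_neg (c := a ≤ y ∧ y < a + 0) (by omega)]

/-- A schedule can be refined to one whose I/O operations move at most one word. -/
theorem Schedule.exists_refinement {W : Type*} {G : CDAG W} {M B : ℕ} (hB : 1 ≤ B)
    (C : Schedule G M B) : ∃ C' : Schedule G M 1, C'.ioCount = B * C.ioCount := by
  have key : ∀ t, ∃ I : ℕ → Config W M, I 0 = C.conf t ∧ (t < C.length → I B = C.conf (t + 1) ∧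
      ∀ l < B, Step G M 1 (C.cost t) (I l) (I (l + 1))) := fun t => by
    by_cases ht : t < C.length
    · obtain ⟨I, h0, h1, h2⟩ := (C.step t ht).exists_refinement hB
      exact ⟨I, h0, fun _ => ⟨h1, h2⟩⟩
    · exact ⟨fun _ => C.conf t, rfl, fun h => absurd h ht⟩
  choose I hI0 hI using key
  have hstart : ∀ t, I (t * B / B) (t * B % B) = C.conf t := fun t => by
    rw [Nat.mul_mod_left, Nat.mul_div_cancel _ hB, hI0]
  refine ⟨{ length := C.length * B
            conf := fun t => I (t / B) (t % B)
            cost := fun t => C.cost (t / B)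
            cache_init := ?_, mem_init := ?_, step := ?_, complete := ?_ }, ?_⟩
  · simpa [hI0] using C.cache_init
  · simpa [hI0] using C.mem_init
  · intro t ht
    have htl : t / B < C.length := by rwa [Nat.div_lt_iff_lt_mul hB]
    obtain ⟨h1, h2⟩ := hI _ htl
    have hm := Nat.mod_lt t hB
    have hs := h2 _ hm
    by_cases hlt : t % B + 1 < B
    · have e : t + 1 = B * (t / B) + (t % B + 1) := by have := Nat.div_add_mod t B; omega
      have e1 : (t + 1) / B = t / B := by
        rw [e, Nat.mul_add_div hB, Nat.div_eq_of_lt hlt, add_zero]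
      have e2 : (t + 1) % B = t % B + 1 := by
        rw [e, Nat.mul_add_mod, Nat.mod_eq_of_lt hlt]
      rwa [e1, e2]
    · have eB : t % B + 1 = B := by omega
      have e : t + 1 = (t / B + 1) * B := by
        have := Nat.div_add_mod t B
        rw [add_mul, mul_comm]; omega
      rw [eB, h1] at hs
      rw [e, hstart]
      exact hs
  · intro v hv
    obtain ⟨t, ht, x, hx⟩ := C.complete v hv
    exact ⟨t * B, Nat.mul_le_mul_right _ ht, x, by rw [hstart]; exact hx⟩
  · have : ∀ L, ∑ t ∈ Finset.range (L * B), C.cost (t / B)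
        = B * ∑ t ∈ Finset.range L, C.cost t := fun L => by
      induction L with
      | zero => simp
      | succ L ih =>
        rw [add_mul, one_mul, Finset.sum_range_add, ih, Finset.sum_range_succ, mul_add]
        congr 1
        rw [Finset.sum_congr rfl (g := fun _ => C.cost L)]
        · simp
        · intro l hl
          rw [mul_comm, Nat.mul_add_div hB, Nat.div_eq_of_lt (Finset.mem_range.1 hl), add_zero]
    exact this _

/-! ### Traces: the sets of values in the cache and in the slow memory -/

/-- The sets of values held over time by a machine with a cache of `M` words that moves at most
one word per step. -/
structure Trace {W : Type*} (G : CDAG W) (M : ℕ) where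
  length : ℕ
  /-- the values in the cache -/
  C : ℕ → Finset W
  /-- the values in the slow memory -/
  S : ℕ → Set W
  /-- the values evaluated in a step -/
  cmp : ℕ → Set W
  /-- the values read in a step -/
  rd : ℕ → Finset W
  /-- the values written in a step -/
  wr : ℕ → Finset W
  cost : ℕ → ℕ
  C_zero : C 0 = ∅
  S_zero : ∀ v ∈ S 0, v ∈ G.inputs
  card_C : ∀ t, (C t).card ≤ M
  C_succ : ∀ t < length, ∀ v ∈ C (t + 1), v ∈ C t ∨ v ∈ cmp t ∨ v ∈ rd t
  S_succ : ∀ t < length, ∀ v ∈ S (t + 1), v ∈ S t ∨ v ∈ wr t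
  rd_sub : ∀ t < length, ∀ v ∈ rd t, v ∈ S t
  wr_sub : ∀ t < length, ∀ v ∈ wr t, v ∈ C t
  card_rd : ∀ t < length, (rd t).card ≤ cost t
  card_wr : ∀ t < length, (wr t).card ≤ cost t
  cost_le : ∀ t < length, cost t ≤ 1
  cmp_pred : ∀ t < length, ∀ v ∈ cmp t, (G.pred v).Nonempty ∧ ∀ u ∈ G.pred v, u ∈ C t
  complete : ∀ v ∈ G.verts, ∃ t ≤ length, v ∈ C t

/-- The values in the cache. -/
noncomputable def Config.cached {W : Type*} {M : ℕ} (c : Config W M) : Finset W := by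
  classical exact Finset.eraseNone (Finset.univ.image c.cache)

theorem Config.mem_cached {W : Type*} {M : ℕ} {c : Config W M} {v : W} :
    v ∈ c.cached ↔ ∃ x, c.cache x = some v := by
  simp [Config.cached]

theorem Config.card_cached_le {W : Type*} {M : ℕ} (c : Config W M) : c.cached.card ≤ M := by
  classical
  have h : c.cached.card ≤ (Finset.univ.image c.cache).card := by
    rw [← Finset.card_map Function.Embedding.some]
    apply Finset.card_le_card
    intro o ho
    obtain ⟨v, hv, rfl⟩ := Finset.mem_map.1 ho
    obtain ⟨x, hx⟩ := Config.mem_cached.1 hv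
    exact Finset.mem_image.2 ⟨x, Finset.mem_univ _, hx⟩
  exact h.trans (Finset.card_image_le.trans (by simp))

theorem Option.card_toFinset_le_one {W : Type*} (o : Option W) : o.toFinset.card ≤ 1 := by
  cases o <;> simp

/-- An operation of width 1 involves one address, hence at most one value. Inclusions suffice, since
overwriting can only destroy values. -/
theorem Step.exists_sets {W : Type*} {G : CDAG W} {M k : ℕ} {c d : Config W M}
    (h : Step G M 1 k c d) : ∃ (cmp : Set W) (rd wr : Finset W),
      (∀ v ∈ d.cached, v ∈ c.cached ∨ v ∈ cmp ∨ v ∈ rd) ∧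
      (∀ v, (∃ a, d.mem a = some v) → (∃ a, c.mem a = some v) ∨ v ∈ wr) ∧
      (∀ v ∈ rd, ∃ a, c.mem a = some v) ∧ (∀ v ∈ wr, v ∈ c.cached) ∧
      rd.card ≤ k ∧ wr.card ≤ k ∧ k ≤ 1 ∧
      ∀ v ∈ cmp, (G.pred v).Nonempty ∧ ∀ u ∈ G.pred v, u ∈ c.cached := by
  simp only [Config.mem_cached]
  cases h with
  | compute _ v hv hne hop y =>
    refine ⟨{v}, ∅, ∅, ?_, by simp, by simp, by simp, by simp, by simp, by simp, ?_⟩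
    · rintro u ⟨x, hx⟩
      by_cases hxy : x = y
      · subst hxy
        right; left
        simpa using hx.symm
      · exact Or.inl ⟨x, by simpa [hxy] using hx⟩
    · rintro u rfl
      exact ⟨hne, hop⟩
  | move _ x y =>
    refine ⟨∅, ∅, ∅, ?_, by simp, by simp, by simp, by simp, by simp, by simp, by simp⟩
    rintro u ⟨z, hz⟩
    by_cases hzy : z = y
    · subst hzy
      exact Or.inl ⟨x, by simpa using hz⟩
    · exact Or.inl ⟨z, by simpa [hzy] using hz⟩
  | read _ a s len hlen hs =>
    refine ⟨∅, (c.mem a).toFinset, ∅, ?_, by simp, ?_, by simp, ?_, by simp, le_rfl, by simp⟩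
    · rintro u ⟨x, hx⟩
      dsimp only at hx
      split_ifs at hx with hc
      · have : a + (x.val - s) = a := by omega
        rw [this] at hx
        right; right
        simp [hx]
      · exact Or.inl ⟨x, hx⟩
    · intro v hv
      exact ⟨a, by simpa using hv⟩
    · exact Option.card_toFinset_le_one _
  | write _ a s len hlen hs =>
    -- An empty write may start at `s = M`, where there is no cache word.
    by_cases hl : len = 0
    · refine ⟨∅, ∅, ∅, fun v hv => Or.inl hv, ?_, by simp, by simp, by simp, by simp, le_rfl,
        by simp⟩
      rintro v ⟨y, hy⟩
      dsimp only at hy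
      rw [dif_neg (by omega)] at hy
      exact Or.inl ⟨y, hy⟩
    · refine ⟨∅, ∅, (c.cache ⟨s, by omega⟩).toFinset, fun v hv => Or.inl hv, ?_, by simp, ?_,
        by simp, ?_, le_rfl, by simp⟩
      · rintro v ⟨y, hy⟩
        dsimp only at hy
        split_ifs at hy with hc
        · have : s + (y - a) = s := by omega
          simp only [this] at hy
          right
          simp [hy]
        · exact Or.inl ⟨y, hy⟩
      · intro v hv
        exact ⟨_, by simpa using hv⟩
      · exact Option.card_toFinset_le_one _

theorem Schedule.exists_trace {W : Type*} {G : CDAG W} {M : ℕ} (C : Schedule G M 1) :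
    ∃ R : Trace G M, ∑ t ∈ Finset.range R.length, R.cost t = C.ioCount := by
  have key : ∀ t, ∃ (cmp : Set W) (rd wr : Finset W), t < C.length →
      (∀ v ∈ (C.conf (t + 1)).cached, v ∈ (C.conf t).cached ∨ v ∈ cmp ∨ v ∈ rd) ∧
      (∀ v, (∃ a, (C.conf (t + 1)).mem a = some v) →
        (∃ a, (C.conf t).mem a = some v) ∨ v ∈ wr) ∧
      (∀ v ∈ rd, ∃ a, (C.conf t).mem a = some v) ∧ (∀ v ∈ wr, v ∈ (C.conf t).cached) ∧
      rd.card ≤ C.cost t ∧ wr.card ≤ C.cost t ∧ C.cost t ≤ 1 ∧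
      ∀ v ∈ cmp, (G.pred v).Nonempty ∧ ∀ u ∈ G.pred v, u ∈ (C.conf t).cached := fun t => by
    by_cases ht : t < C.length
    · obtain ⟨cmp, rd, wr, h⟩ := (C.step t ht).exists_sets
      exact ⟨cmp, rd, wr, fun _ => h⟩
    · exact ⟨∅, ∅, ∅, fun h => absurd h ht⟩
  choose cmp rd wr h using key
  exact ⟨{ length := C.length
           C := fun t => (C.conf t).cached
           S := fun t => {v | ∃ a, (C.conf t).mem a = some v}
           cmp := cmp, rd := rd, wr := wr, cost := C.cost
           C_zero := by
             ext v
             simp [Config.mem_cached, C.cache_init]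
           S_zero := fun v hv => (C.mem_init v).1 hv
           card_C := fun t => Config.card_cached_le _
           C_succ := fun t ht => (h t ht).1
           S_succ := fun t ht => (h t ht).2.1
           rd_sub := fun t ht => (h t ht).2.2.1
           wr_sub := fun t ht => (h t ht).2.2.2.1
           card_rd := fun t ht => (h t ht).2.2.2.2.1
           card_wr := fun t ht => (h t ht).2.2.2.2.2.1
           cost_le := fun t ht => (h t ht).2.2.2.2.2.2.1
           cmp_pred := fun t ht => (h t ht).2.2.2.2.2.2.2
           complete := fun v hv => by
             obtain ⟨t, ht, x, hx⟩ := C.complete v hv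
             exact ⟨t, ht, Config.mem_cached.2 ⟨x, hx⟩⟩ }, rfl⟩

namespace Trace

variable {W : Type*} {G : CDAG W} {M : ℕ} (R : Trace G M)

/-- Only an evaluation creates a new value: a value that is not an input was evaluated before,
at a time when there was no copy of it, and from then on there always was one. -/
theorem exists_cmp {v : W} (hv : v ∉ G.inputs) {t : ℕ} (ht : t ≤ R.length)
    (h : v ∈ R.C t ∨ v ∈ R.S t) : ∃ t' < t, v ∈ R.cmp t' ∧ v ∉ R.S t' ∧
      ∀ e, t' < e → e ≤ t → v ∈ R.C e ∨ v ∈ R.S e := by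
  induction t with
  | zero =>
    rcases h with h | h
    · simp [R.C_zero] at h
    · exact absurd (R.S_zero v h) hv
  | succ t ih =>
    have ht' : t < R.length := ht
    by_cases hp : v ∈ R.C t ∨ v ∈ R.S t
    · obtain ⟨t', h1, h2, h3, h4⟩ := ih ht'.le hp
      refine ⟨t', by omega, h2, h3, fun e he he' => ?_⟩
      rcases Nat.lt_or_ge t e with hte | hte
      · obtain rfl : e = t + 1 := by omega
        exact h
      · exact h4 e he hte
    · push Not at hp
      refine ⟨t, by omega, ?_, hp.2, fun e he he' => ?_⟩
      · rcases h with h | h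
        · rcases R.C_succ t ht' v h with h | h | h
          · exact absurd h hp.1
          · exact h
          · exact absurd (R.rd_sub t ht' v h) hp.2
        · rcases R.S_succ t ht' v h with h | h
          · exact absurd h hp.2
          · exact absurd (R.wr_sub t ht' v h) hp.1
      · obtain rfl : e = t + 1 := by omega
        exact h

theorem exists_wr {v : W} {t e : ℕ} (hte : t ≤ e) (he : e ≤ R.length) (h : v ∉ R.S t)
    (h' : v ∈ R.S e) : ∃ x, t ≤ x ∧ x < e ∧ v ∈ R.wr x := by
  induction e, hte using Nat.le_induction with
  | base => exact absurd h' h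
  | succ e hte ih =>
    rcases R.S_succ e he v h' with h1 | h1
    · obtain ⟨x, hx, hx', hv⟩ := ih (by omega) h1
      exact ⟨x, hx, by omega, hv⟩
    · exact ⟨e, hte, by omega, h1⟩

open Classical in
/-- The values in the cache at time `a` or read in the steps from `a` to `b`. -/
noncomputable def avail (a b : ℕ) : Finset W :=
  R.C a ∪ (Finset.Ico a b).biUnion R.rd

open Classical in
/-- The values in the cache at time `b` or written in the steps from `a` to `b`. -/
noncomputable def kept (a b : ℕ) : Finset W :=
  R.C b ∪ (Finset.Ico a b).biUnion R.wr

theorem card_avail_le {a b : ℕ} (hb : b ≤ R.length)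
    (h : ∑ t ∈ Finset.Ico a b, R.cost t ≤ M) : (R.avail a b).card ≤ 2 * M := by
  classical
  have h1 : ((Finset.Ico a b).biUnion R.rd).card ≤ ∑ t ∈ Finset.Ico a b, R.cost t :=
    Finset.card_biUnion_le.trans (Finset.sum_le_sum fun t ht =>
      R.card_rd t (by have := Finset.mem_Ico.1 ht; omega))
  have h2 := R.card_C a
  have h3 := Finset.card_union_le (R.C a) ((Finset.Ico a b).biUnion R.rd)
  unfold avail
  omega

theorem card_kept_le {a b : ℕ} (hb : b ≤ R.length)
    (h : ∑ t ∈ Finset.Ico a b, R.cost t ≤ M) : (R.kept a b).card ≤ 2 * M := by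
  classical
  have h1 : ((Finset.Ico a b).biUnion R.wr).card ≤ ∑ t ∈ Finset.Ico a b, R.cost t :=
    Finset.card_biUnion_le.trans (Finset.sum_le_sum fun t ht =>
      R.card_wr t (by have := Finset.mem_Ico.1 ht; omega))
  have h2 := R.card_C b
  have h3 := Finset.card_union_le (R.C b) ((Finset.Ico a b).biUnion R.wr)
  unfold kept
  omega

/-- `v` is in the cache at some time from `a` to `b`. -/
def Accessible (a b : ℕ) (v : W) : Prop := ∃ t, a ≤ t ∧ t ≤ b ∧ v ∈ R.C t

variable {R} in
-- Going back in time, a cached value was there at the start, was read, or was evaluated from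
-- operands that were then in the cache. Repeated evaluation is covered as well.
theorem Accessible.mem_avail_or_pred {a b : ℕ} (hb : b ≤ R.length) {v : W}
    (h : R.Accessible a b v) : v ∈ R.avail a b ∨
      ((G.pred v).Nonempty ∧ ∀ u ∈ G.pred v, R.Accessible a b u) := by
  classical
  obtain ⟨t, hat, htb, hv⟩ := h
  induction t, hat using Nat.le_induction with
  | base => exact Or.inl (Finset.mem_union_left _ hv)
  | succ t hat ih =>
    rcases R.C_succ t (by omega) v hv with h | h | h
    · exact ih (by omega) h
    · obtain ⟨h1, h2⟩ := R.cmp_pred t (by omega) v h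
      exact Or.inr ⟨h1, fun u hu => ⟨t, hat, by omega, h2 u hu⟩⟩
    · exact Or.inl (Finset.mem_union_right _
        (Finset.mem_biUnion.2 ⟨t, Finset.mem_Ico.2 ⟨hat, by omega⟩, h⟩))

theorem exists_rd {v : W} (hv : v ∈ G.inputs) {t : ℕ} (ht : t ≤ R.length) (h : v ∈ R.C t) :
    ∃ t' < R.length, v ∈ R.rd t' := by
  classical
  rcases Accessible.mem_avail_or_pred (R := R) (a := 0) le_rfl ⟨t, Nat.zero_le _, ht, h⟩ with h | h
  · rcases Finset.mem_union.1 h with h | h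
    · simp [R.C_zero] at h
    · obtain ⟨t', h1, h2⟩ := Finset.mem_biUnion.1 h
      exact ⟨t', (Finset.mem_Ico.1 h1).2, h2⟩
  · exact absurd hv.2 h.1.ne_empty

/-- Every input is read at least once. -/
theorem card_le_sum_cost (A : Finset W) (hA : ∀ v ∈ A, v ∈ G.inputs) :
    A.card ≤ ∑ t ∈ Finset.range R.length, R.cost t := by
  classical
  have h1 : A ⊆ (Finset.range R.length).biUnion R.rd := fun v hv => by
    obtain ⟨t, ht, h⟩ := R.complete v (hA v hv).1
    obtain ⟨t', h1, h2⟩ := R.exists_rd (hA v hv) ht h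
    exact Finset.mem_biUnion.2 ⟨t', Finset.mem_range.2 h1, h2⟩
  exact (Finset.card_le_card h1).trans (Finset.card_biUnion_le.trans
    (Finset.sum_le_sum fun t ht => R.card_rd t (Finset.mem_range.1 ht)))

end Trace

/-- A sequence of steps of cost at most `1` can be cut into segments of cost at most `M`, all but
one of which have cost `M`. -/
theorem exists_segments (M : ℕ) (hM : 1 ≤ M) (T : ℕ) (cost : ℕ → ℕ)
    (hc : ∀ t < T, cost t ≤ 1) : ∃ (h : ℕ) (b : ℕ → ℕ), b 0 = 0 ∧ b h = T ∧ Monotone b ∧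
      (∀ s, b s ≤ T) ∧ (∀ s, ∑ t ∈ Finset.Ico (b s) (b (s + 1)), cost t ≤ M) ∧
      h * M ≤ (∑ t ∈ Finset.range T, cost t) + M := by
  classical
  set Q : ℕ → ℕ := fun t => ∑ x ∈ Finset.range t, cost x with hQ
  have hQmono : Monotone Q := fun a b hab =>
    Finset.sum_le_sum_of_subset (Finset.range_mono hab)
  -- The cut `b s` is the first time at which the accumulated cost reaches `s * M`, or `T` if there
  -- is none.
  set P : ℕ → ℕ → Prop := fun s t => ∀ t' < t, Q t' < s * M with hP
  set b : ℕ → ℕ := fun s => Nat.findGreatest (P s) T with hb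
  have hbT : ∀ s, b s ≤ T := fun s => Nat.findGreatest_le _
  have hPb : ∀ s, P s (b s) := fun s =>
    Nat.findGreatest_spec (P := P s) (Nat.zero_le T) (fun t' ht' => absurd ht' (by omega))
  have hup : ∀ s, Q (b s) ≤ s * M := fun s => by
    rcases Nat.eq_zero_or_pos (b s) with h0 | h0
    · simp [h0, hQ]
    · have h1 := hPb s (b s - 1) (by omega)
      have h2 := hc (b s - 1) (by have := hbT s; omega)
      have h3 : Q (b s) = Q (b s - 1) + cost (b s - 1) := by
        simp only [hQ]
        rw [← Finset.sum_range_succ]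
        congr 2; omega
      omega
  have hlow : ∀ s, b s < T → s * M ≤ Q (b s) := fun s hs => by
    by_contra hlt
    push Not at hlt
    have : P s (b s + 1) := fun t' ht' =>
      (hQmono (Nat.lt_succ_iff.1 ht')).trans_lt hlt
    have := Nat.le_findGreatest (P := P s) (n := T) (by omega) this
    change b s + 1 ≤ b s at this
    omega
  have hbm : Monotone b := fun s s' hs => Nat.le_findGreatest (hbT s) fun t' ht' =>
    (hPb s t' ht').trans_le (Nat.mul_le_mul_right _ hs)
  refine ⟨Q T / M + 1, b, ?_, ?_, hbm, hbT, fun s => ?_, ?_⟩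
  · by_contra h0
    have := hPb 0 0 (by omega)
    omega
  · refine le_antisymm (hbT _) (Nat.le_findGreatest le_rfl fun t' ht' => ?_)
    refine (hQmono ht'.le).trans_lt ?_
    have := Nat.div_add_mod (Q T) M
    have := Nat.mod_lt (Q T) hM
    rw [add_mul, mul_comm]
    omega
  · have h1 : ∑ t ∈ Finset.Ico (b s) (b (s + 1)), cost t = Q (b (s + 1)) - Q (b s) := by
      have := Finset.sum_range_add_sum_Ico cost (hbm (show s ≤ s + 1 by omega))
      simp only [hQ]
      omega
    rw [h1]
    rcases Nat.lt_or_ge (b s) T with h | h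
    · have h2 := hlow s h
      have h3 := hup (s + 1)
      rw [add_mul, one_mul] at h3
      omega
    · have h2 : b s = b (s + 1) := le_antisymm (hbm (Nat.le_succ s)) ((hbT _).trans h)
      rw [h2]; omega
  · have := Nat.div_mul_le_self (Q T) M
    rw [add_mul, one_mul]
    exact Nat.add_le_add_right this M

theorem exists_segment {h : ℕ} {b : ℕ → ℕ} (h0 : b 0 = 0) {t : ℕ} (ht : t < b h) :
    ∃ s < h, b s ≤ t ∧ t < b (s + 1) := by
  induction h with
  | zero => omega
  | succ h ih =>
    rcases Nat.lt_or_ge t (b h) with hlt | hge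
    · obtain ⟨s, hs, h1⟩ := ih hlt
      exact ⟨s, by omega, h1⟩
    · exact ⟨h, by omega, hge, ht⟩

/-- The counting argument: if the leaves of the trees `u ∈ T` are distributed over `h` segments,
such that in each segment the squares of the numbers of leaves sum up to at most `(2 M) ^ 2`, and
all but `2 M` trees with leaves in the segment are assigned to it, there are few leaves. -/
theorem sum_card_le_of_segments {ι κ : Type*} [DecidableEq ι] (T : Finset ι) (K : ι → Finset κ)
    (σ : ι → κ → ℕ) (ρ : ι → ℕ) (h M : ℕ) (hM : 1 ≤ M)
    (hσ : ∀ u ∈ T, ∀ k ∈ K u, σ u k < h)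
    (hsq : ∀ s < h, ∑ u ∈ T, ((K u).filter fun k => σ u k = s).card ^ 2 ≤ (2 * M) ^ 2)
    (hcard : ∀ s < h, (T.filter fun u => ∃ k ∈ K u, σ u k = s).card
      ≤ 2 * M + (T.filter fun u => ρ u = s).card) :
    ∑ u ∈ T, ((K u).card : ℝ) ≤ h * (3 * M * √(M : ℝ)) + √(M : ℝ) * T.card := by
  classical
  set d : ℕ → ι → ℕ := fun s u => ((K u).filter fun k => σ u k = s).card with hd
  have hM' : (1 : ℝ) ≤ M := by exact_mod_cast hM
  have hpos : (0 : ℝ) < √(M : ℝ) := Real.sqrt_pos.2 (by linarith)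
  have hsqM : √(M : ℝ) * √(M : ℝ) = M := Real.mul_self_sqrt (by linarith)
  have h1 : ∀ u ∈ T, ((K u).card : ℝ) = ∑ s ∈ Finset.range h, (d s u : ℝ) := fun u hu => by
    rw [Finset.card_eq_sum_card_fiberwise (f := σ u) (t := Finset.range h)]
    · push_cast; rfl
    · intro k hk
      simpa using hσ u hu k hk
  have h2 : ∀ s < h, ∑ u ∈ T, (d s u : ℝ) ≤ 3 * M * √(M : ℝ)
      + √(M : ℝ) * (T.filter fun u => ρ u = s).card := fun s hs => by
    set U := T.filter fun u => ∃ k ∈ K u, σ u k = s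
    have e1 : ∑ u ∈ T, (d s u : ℝ) = ∑ u ∈ U, (d s u : ℝ) := by
      refine (Finset.sum_subset (Finset.filter_subset _ _) fun u hu hu' => ?_).symm
      have : d s u = 0 := by
        simp only [hd, Finset.card_eq_zero, Finset.filter_eq_empty_iff]
        intro k hk hk'
        exact hu' (Finset.mem_filter.2 ⟨hu, k, hk, hk'⟩)
      simp [this]
    -- AM–GM in a form linear in the number of trees, so that the roots assigned to the segments can
    -- be summed over all segments. The weight turns `(2 * M) ^ 2` into `M * √M`.
    have e2 : ∀ u ∈ U, (d s u : ℝ) ≤ (d s u : ℝ) ^ 2 / (4 * √(M : ℝ)) + √(M : ℝ) :=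
      fun u _ => by
        rw [← sub_nonneg]
        have : (d s u : ℝ) ^ 2 / (4 * √(M : ℝ)) + √(M : ℝ) - d s u
            = ((d s u : ℝ) - 2 * √(M : ℝ)) ^ 2 / (4 * √(M : ℝ)) := by
          field_simp; ring
        rw [this]; positivity
    have e3 : ∑ u ∈ U, (d s u : ℝ) ^ 2 ≤ (2 * M) ^ 2 := by
      have : ∑ u ∈ U, (d s u) ^ 2 ≤ (2 * M) ^ 2 :=
        (Finset.sum_le_sum_of_subset (Finset.filter_subset _ _)).trans (hsq s hs)
      exact_mod_cast this
    have e4 : (U.card : ℝ) ≤ 2 * M + (T.filter fun u => ρ u = s).card := by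
      exact_mod_cast hcard s hs
    calc ∑ u ∈ T, (d s u : ℝ) = ∑ u ∈ U, (d s u : ℝ) := e1
      _ ≤ ∑ u ∈ U, ((d s u : ℝ) ^ 2 / (4 * √(M : ℝ)) + √(M : ℝ)) := Finset.sum_le_sum e2
      _ = (∑ u ∈ U, (d s u : ℝ) ^ 2) / (4 * √(M : ℝ)) + √(M : ℝ) * U.card := by
        rw [Finset.sum_add_distrib, Finset.sum_div, Finset.sum_const, nsmul_eq_mul, mul_comm √_]
      _ ≤ (2 * M) ^ 2 / (4 * √(M : ℝ))
          + √(M : ℝ) * (2 * M + (T.filter fun u => ρ u = s).card) := by gcongr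
      _ = _ := by
        have : (2 * (M : ℝ)) ^ 2 / (4 * √(M : ℝ)) = M * √(M : ℝ) := by
          rw [div_eq_iff (by positivity)]
          linear_combination (-4 * (M : ℝ)) * hsqM
        rw [this]; ring
  have h3 : ∑ s ∈ Finset.range h, ((T.filter fun u => ρ u = s).card : ℝ) ≤ T.card := by
    have : ∑ s ∈ Finset.range h, (T.filter fun u => ρ u = s).card ≤ T.card := by
      rw [← Finset.card_biUnion]
      · exact Finset.card_le_card (Finset.biUnion_subset.2 fun s _ => Finset.filter_subset _ _)
      · intro s _ s' _ hss
        refine Finset.disjoint_left.2 fun u hu hu' => hss ?_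
        rw [← (Finset.mem_filter.1 hu).2, (Finset.mem_filter.1 hu').2]
    exact_mod_cast this
  calc ∑ u ∈ T, ((K u).card : ℝ) = ∑ u ∈ T, ∑ s ∈ Finset.range h, (d s u : ℝ) :=
        Finset.sum_congr rfl h1
    _ = ∑ s ∈ Finset.range h, ∑ u ∈ T, (d s u : ℝ) := Finset.sum_comm
    _ ≤ ∑ s ∈ Finset.range h, (3 * M * √(M : ℝ)
        + √(M : ℝ) * (T.filter fun u => ρ u = s).card) :=
        Finset.sum_le_sum fun s hs => h2 s (Finset.mem_range.1 hs)
    _ = h * (3 * M * √(M : ℝ))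
        + √(M : ℝ) * ∑ s ∈ Finset.range h, ((T.filter fun u => ρ u = s).card : ℝ) := by
        rw [Finset.sum_add_distrib, Finset.mul_sum]; simp
    _ ≤ _ := by gcongr

/-! ### Paths in binary trees -/

namespace BTree

variable {β : Type*}

@[simp] theorem subtree_nil (t : BTree β) : t.subtree [] = some t := by
  cases t <;> rfl

theorem subtree_append (t : BTree β) (p q : List Bool) :
    t.subtree (p ++ q) = (t.subtree p).bind fun u => u.subtree q := by
  induction p generalizing t with
  | nil => simp
  | cons a p ih => cases t <;> cases a <;> simp [subtree, ih]

theorem exists_subtree_leaf {t : BTree β} {b : β} (h : b ∈ t.leaves) :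
    ∃ p, t.subtree p = some (.leaf b) := by
  induction t with
  | leaf c =>
    obtain rfl : b = c := by simpa [leaves] using h
    exact ⟨[], rfl⟩
  | unary t ih =>
    obtain ⟨p, hp⟩ := ih h
    exact ⟨false :: p, hp⟩
  | binary l r ihl ihr =>
    rcases List.mem_append.1 h with h | h
    · obtain ⟨p, hp⟩ := ihl h
      exact ⟨false :: p, hp⟩
    · obtain ⟨p, hp⟩ := ihr h
      exact ⟨true :: p, hp⟩

theorem subtree_concat {t u : BTree β} {p : List Bool} {a : Bool}
    (h : t.subtree (p ++ [a]) = some u) :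
    (a = false ∧ t.subtree p = some (.unary u)) ∨
      ∃ l r, t.subtree p = some (.binary l r) ∧ (u = l ∧ a = false ∨ u = r ∧ a = true) := by
  rw [subtree_append] at h
  cases hp : t.subtree p with
  | none => simp [hp] at h
  | some v =>
    rw [hp] at h
    cases v <;> cases a <;> simp_all [subtree]

end BTree

/-! ### Trees touched by a set of values -/

/-- The subproblem and the variable in whose tree a vertex lies. -/
def CYKVertex.owner {N : Type*} : CYKVertex N → (ℕ × ℕ) × N
  | .source i j A => ((i, j), A)
  | .varNode i j A _ => ((i, j), A)
  | .ruleNode i j r _ => ((i, j), r.lhs)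

/-- The vertices of the tree of `S(i, j)` and the rule `r`. -/
def CYKVertex.InRuleTree {N : Type*} (i j : ℕ) (r : BinaryRule N) (v : CYKVertex N) : Prop :=
  ∃ p, v = .ruleNode i j r p

namespace CYKTrees

variable {α : Type*} {g : ContextFreeGrammar α} {n : ℕ} (τ : CYKTrees g n)

theorem mem_preds_ruleNode {i j : ℕ} {r : BinaryRule g.NT} {p : List Bool} {a : Bool}
    {t : BTree ℕ} (h : (τ.ruleTree i j r).subtree (p ++ [a]) = some t) :
    (.ruleNode i j r (p ++ [a])) ∈ τ.preds (.ruleNode i j r p) ∧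
      ∃ u, (τ.ruleTree i j r).subtree p = some u := by
  rcases BTree.subtree_concat h with ⟨rfl, h'⟩ | ⟨l, s, h', ⟨-, rfl⟩ | ⟨-, rfl⟩⟩ <;>
    simp [preds, h']

theorem preds_ruleNode_nonempty {i j : ℕ} {r : BinaryRule g.NT} {p : List Bool}
    {t : BTree ℕ} (h : (τ.ruleTree i j r).subtree p = some t) :
    (τ.preds (.ruleNode i j r p)).Nonempty := by
  cases t <;> simp [preds, h, Set.insert_nonempty]

theorem mem_preds_varVertex {i j : ℕ} {A : g.NT} {p : List Bool} {a : Bool}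
    {t : BTree (BinaryRule g.NT)} (h : (τ.varTree i j A).subtree (p ++ [a]) = some t) :
    τ.varVertex i j A (p ++ [a]) ∈ τ.preds (τ.varVertex i j A p) ∧
      (τ.varVertex i j A p).owner = ((i, j), A) ∧
      ∃ u, (τ.varTree i j A).subtree p = some u := by
  rcases BTree.subtree_concat h with ⟨rfl, h'⟩ | ⟨l, s, h', ⟨-, rfl⟩ | ⟨-, rfl⟩⟩
  · have e : τ.varVertex i j A p = .varNode i j A p := by simp [varVertex, h']
    rw [e]; simp [preds, h', CYKVertex.owner]
  · have e : τ.varVertex i j A p = .varNode i j A p := by simp [varVertex, h']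
    rw [e]; simp [preds, h', CYKVertex.owner]
  · have e : τ.varVertex i j A p = .varNode i j A p := by simp [varVertex, h']
    rw [e]; simp [preds, h', CYKVertex.owner]

theorem preds_leaf {i j k : ℕ} {r : BinaryRule g.NT} {p : List Bool}
    (h : (τ.ruleTree i j r).subtree p = some (.leaf k)) :
    τ.preds (.ruleNode i j r p) = {τ.varRoot i k r.fst, τ.varRoot (k + 1) j r.snd} := by
  simp [preds, h]

variable {τ} {M : ℕ} {R : Trace τ.cdag M} {a b : ℕ}

/-- If the tree of `S(i, j)` and `A` holds no available value, its root can be reached only if the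
roots of the subproblems that are combined by some rule are all reached. -/
theorem accessible_of_untouched (hb : b ≤ R.length) {i j : ℕ} {A : g.NT} (hi : 1 ≤ i)
    (hj : j ≤ n) (h : R.Accessible a b (τ.varRoot i j A))
    (hA : ∀ v ∈ R.avail a b, v.owner ≠ ((i, j), A)) :
    i < j ∧ ∃ X Y, ∀ k, i ≤ k → k < j →
      R.Accessible a b (τ.varRoot i k X) ∧ R.Accessible a b (τ.varRoot (k + 1) j Y) := by
  have down : ∀ v, R.Accessible a b v → v.owner = ((i, j), A) →
      (τ.preds v).Nonempty ∧ ∀ u ∈ τ.preds v, R.Accessible a b u := fun v hv hvo => by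
    rcases hv.mem_avail_or_pred hb with h' | h'
    · exact absurd hvo (hA v h')
    · exact h'
  by_cases hc : i < j ∧ (rulesFor g A).Nonempty
  · have hroot : τ.varRoot i j A = τ.varVertex i j A [] := by simp [varRoot, hc]
    rw [hroot] at h
    -- No vertex owned by `((i, j), A)` is available, so accessibility descends from the root
    -- through the variable tree, then through the tree of one rule `r` to all its leaves.
    have hvar : ∀ p t, (τ.varTree i j A).subtree p = some t →
        R.Accessible a b (τ.varVertex i j A p) := fun p => by
      induction p using List.reverseRecOn with
      | nil => exact fun _ _ => h
      | append_singleton p c ih =>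
        intro t ht
        obtain ⟨h1, h2, u, hu⟩ := τ.mem_preds_varVertex ht
        exact (down _ (ih u hu) h2).2 _ h1
    obtain ⟨r, hr⟩ := hc.2
    obtain ⟨p, hp⟩ := BTree.exists_subtree_leaf
      (((τ.varTree_leaves i j hi hc.1 hj A hc.2).2 r).2 hr)
    have hg : R.Accessible a b (.ruleNode i j r []) := by
      have := hvar p _ hp
      rwa [varVertex, hp] at this
    have ho : ∀ p, (CYKVertex.ruleNode i j r p).owner = ((i, j), A) := fun p => by
      simp [CYKVertex.owner, hr.2]
    have hrule : ∀ p t, (τ.ruleTree i j r).subtree p = some t →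
        R.Accessible a b (.ruleNode i j r p) := fun p => by
      induction p using List.reverseRecOn with
      | nil => exact fun _ _ => hg
      | append_singleton p c ih =>
        intro t ht
        obtain ⟨h1, u, hu⟩ := τ.mem_preds_ruleNode ht
        exact (down _ (ih u hu) (ho p)).2 _ h1
    refine ⟨hc.1, r.fst, r.snd, fun k hik hkj => ?_⟩
    obtain ⟨q, hq⟩ := BTree.exists_subtree_leaf
      (((τ.ruleTree_leaves i j hi hc.1 hj r hr.1).2 k).2 ⟨hik, hkj⟩)
    have h1 := (down _ (hrule q _ hq) (ho q)).2
    rw [τ.preds_leaf hq] at h1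
    exact ⟨h1 _ (by simp), h1 _ (by simp)⟩
  · have hroot : τ.varRoot i j A = .source i j A := by simp [varRoot, hc]
    rw [hroot] at h
    obtain ⟨⟨u, hu⟩, -⟩ := down _ h rfl
    exact absurd hu (by simp [preds])

open Classical in
/-- The trees that hold an available value. -/
noncomputable def touched (R : Trace τ.cdag M) (a b : ℕ) : Finset ((ℕ × ℕ) × g.NT) :=
  (R.avail a b).image CYKVertex.owner

theorem accessible_of_not_mem_touched (hb : b ≤ R.length) {i j : ℕ} {A : g.NT} (hi : 1 ≤ i)
    (hj : j ≤ n) (h : R.Accessible a b (τ.varRoot i j A)) (hA : ((i, j), A) ∉ touched R a b) :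
    i < j ∧ ∃ X Y, ∀ k, i ≤ k → k < j →
      R.Accessible a b (τ.varRoot i k X) ∧ R.Accessible a b (τ.varRoot (k + 1) j Y) := by
  classical
  refine accessible_of_untouched hb hi hj h fun v hv hvo => hA ?_
  exact Finset.mem_image.2 ⟨v, hv, hvo⟩

/-- If the tree itself is untouched, the split at `k = j - 1` makes a root of `S(j, j)` accessible.
That is an input, so it must be available. -/
theorem exists_mem_touched (hb : b ≤ R.length) {i j : ℕ} {A : g.NT} (hi : 1 ≤ i)
    (hj : j ≤ n) (h : R.Accessible a b (τ.varRoot i j A)) :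
    ∃ i' A', ((i', j), A') ∈ touched R a b := by
  by_cases hA : ((i, j), A) ∈ touched R a b
  · exact ⟨i, A, hA⟩
  · obtain ⟨hij, X, Y, h'⟩ := accessible_of_not_mem_touched hb hi hj h hA
    have h1 := (h' (j - 1) (by omega) (by omega)).2
    rw [show j - 1 + 1 = j by omega] at h1
    by_contra hcon
    push Not at hcon
    have := (accessible_of_not_mem_touched hb (by omega) hj h1 (hcon j Y)).1
    omega

/-- In a segment with few available values, the roots of large subproblems cannot be evaluated
without an available value in their trees. -/
theorem mem_touched_of_card_le (hb : b ≤ R.length) {i j : ℕ} {A : g.NT} (hi : 1 ≤ i)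
    (hj : j ≤ n) (h : R.Accessible a b (τ.varRoot i j A))
    (hcard : i + (R.avail a b).card ≤ j) : ((i, j), A) ∈ touched R a b := by
  classical
  by_contra hA
  obtain ⟨hij, X, Y, h'⟩ := accessible_of_not_mem_touched hb hi hj h hA
  -- An untouched tree needs a root of `S(i, k)` for every `k < j`, and each right end `k` costs a
  -- touched tree of its own. These are `j - i + 1` trees, one more than `hcard` permits.
  have key : ∀ k ∈ Finset.Icc i j, ∃ i' A', ((i', k), A') ∈ touched R a b := fun k hk => by
    obtain ⟨h1, h2⟩ := Finset.mem_Icc.1 hk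
    rcases h2.lt_or_eq with h3 | rfl
    · exact exists_mem_touched hb hi (by omega) (h' k h1 h3).1
    · exact exists_mem_touched hb hi hj h
  have hsub : Finset.Icc i j ⊆ (touched R a b).image fun x => x.1.2 := fun k hk => by
    obtain ⟨i', A', hm⟩ := key k hk
    exact Finset.mem_image.2 ⟨_, hm, rfl⟩
  have h1 := Finset.card_le_card hsub
  have h2 := (Finset.card_image_le (s := touched R a b) (f := fun x => x.1.2))
  have h3 : (touched R a b).card ≤ (R.avail a b).card := Finset.card_image_le
  rw [Nat.card_Icc] at h1
  omega

/-- In every tree of a rule, a root evaluated at time `t₀` depends on an evaluation of each vertex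
such that the root is evaluated in the same segment, or else some value of the tree is kept at the
end of the segment. -/
theorem exists_useful_cmp {β : ℕ → ℕ} {h : ℕ} (hβ0 : β 0 = 0) (hβh : β h = R.length)
    (hβm : Monotone β) (hβ : ∀ s, β s ≤ R.length)
    {i j : ℕ} {r : BinaryRule g.NT} {s₀ t₀ : ℕ}
    (hs₀ : s₀ < h) (ht₀ : β s₀ ≤ t₀) (ht₀' : t₀ < β (s₀ + 1))
    (hroot : .ruleNode i j r [] ∈ R.cmp t₀) (p : List Bool) :
    ∀ t, (τ.ruleTree i j r).subtree p = some t → ∃ s < h, ∃ x, β s ≤ x ∧ x < β (s + 1) ∧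
      .ruleNode i j r p ∈ R.cmp x ∧
      (s₀ = s ∨ ∃ v ∈ R.kept (β s) (β (s + 1)), v.InRuleTree i j r) := by
  classical
  induction p using List.reverseRecOn with
  | nil => exact fun _ _ => ⟨s₀, hs₀, t₀, ht₀, ht₀', hroot, Or.inl rfl⟩
  | append_singleton p c ih =>
    intro t ht
    obtain ⟨h1, u, hu⟩ := τ.mem_preds_ruleNode ht
    obtain ⟨s, hs, x, hx, hx', hcmp, huse⟩ := ih u hu
    have hxl : x < R.length := hx'.trans_le (hβ _)
    have hC : .ruleNode i j r (p ++ [c]) ∈ R.C x := (R.cmp_pred x hxl _ hcmp).2 _ h1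
    have hne : (.ruleNode i j r (p ++ [c])) ∉ τ.cdag.inputs := by
      rintro ⟨-, he⟩
      replace he : τ.preds (.ruleNode i j r (p ++ [c])) = ∅ := he
      exact (τ.preds_ruleNode_nonempty ht).ne_empty he
    -- The copy used by the parent goes back to an evaluation at time `y`, since which a copy has
    -- always existed.
    obtain ⟨y, hyx, hy, hyS, hpres⟩ := R.exists_cmp hne hxl.le (Or.inl hC)
    obtain ⟨s', hs', hy1, hy2⟩ := exists_segment (h := h) hβ0 (t := y) (by omega)
    refine ⟨s', hs', y, hy1, hy2, hy, ?_⟩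
    by_cases hss : s' = s
    · subst hss; exact huse
    · right
      have hle : β (s' + 1) ≤ x := by
        have : s' < s := by
          by_contra hlt
          have : s + 1 ≤ s' := by omega
          have := hβm this
          omega
        exact (hβm (show s' + 1 ≤ s from this)).trans hx
      refine ⟨.ruleNode i j r (p ++ [c]), ?_, _, rfl⟩
      -- At the end of the earlier segment a copy is in the cache or in the slow memory. In the
      -- latter case it was written after `y`, within that segment, because it was not in the slow
      -- memory at `y`.
      unfold Trace.kept
      rcases hpres _ hy2 hle with h' | h'
      · exact Finset.mem_union_left _ h'
      · obtain ⟨z, hz1, hz2, hz3⟩ := R.exists_wr hy2.le (hβ _) hyS h'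
        exact Finset.mem_union_right _ (Finset.mem_biUnion.2
          ⟨z, Finset.mem_Ico.2 ⟨by omega, hz2⟩, hz3⟩)

end CYKTrees

/-! ### Counting the leaves of the rule trees -/

theorem finite_binaryRules {α : Type*} (g : ContextFreeGrammar α) : (binaryRules g).Finite := by
  refine Set.Finite.preimage (f := fun r : BinaryRule g.NT =>
    (⟨r.lhs, [.nonterminal r.fst, .nonterminal r.snd]⟩ : ContextFreeRule α g.NT)) ?_
    g.rules.finite_toSet
  rintro ⟨a, b, c⟩ - ⟨a', b', c'⟩ - h
  simp only [ContextFreeRule.mk.injEq, List.cons.injEq, Symbol.nonterminal.injEq, and_true] at h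
  obtain ⟨rfl, rfl, rfl⟩ := h
  rfl

/-- Rules with equal right-hand sides share their operands, so a pair of operands would not
determine the rule. One rule per right-hand side is kept, which is why the bound involves `Γ`. -/
theorem exists_representatives {α : Type*} (g : ContextFreeGrammar α) :
    ∃ P : Finset (BinaryRule g.NT), (∀ r ∈ P, r ∈ binaryRules g) ∧ P.card = numRHS g ∧
      ∀ r ∈ P, ∀ r' ∈ P, r.fst = r'.fst → r.snd = r'.snd → r = r' := by
  obtain ⟨P, hP, hb⟩ := Set.exists_subset_bijOn (binaryRules g)
    (fun r : BinaryRule g.NT => (r.fst, r.snd))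
  have hfin : P.Finite := (finite_binaryRules g).subset hP
  refine ⟨hfin.toFinset, fun r hr => hP (hfin.mem_toFinset.1 hr), ?_, ?_⟩
  · rw [numRHS, ← hb.image_eq, hb.injOn.ncard_image, Set.ncard_eq_toFinset_card P hfin]
  · intro r hr r' hr' h1 h2
    exact hb.injOn (hfin.mem_toFinset.1 hr) (hfin.mem_toFinset.1 hr') (Prod.ext h1 h2)

/-- The leaves `(i, k, j)` with rule `r` whose operands lie in `A`: the squares of their numbers in
the trees sum up to at most the number of pairs from `A`. -/
theorem sum_card_sq_le {N : Type*} (T : Finset ((ℕ × ℕ) × BinaryRule N))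
    (K : (ℕ × ℕ) × BinaryRule N → Finset ℕ) (A : Finset ((ℕ × ℕ) × N))
    (hT : ∀ u ∈ T, ∀ u' ∈ T, u.2.fst = u'.2.fst → u.2.snd = u'.2.snd → u.2 = u'.2)
    (hl : ∀ u ∈ T, ∀ k ∈ K u, ((u.1.1, k), u.2.fst) ∈ A)
    (hr : ∀ u ∈ T, ∀ k ∈ K u, ((k + 1, u.1.2), u.2.snd) ∈ A) :
    ∑ u ∈ T, (K u).card ^ 2 ≤ A.card ^ 2 := by
  have h1 : ∑ u ∈ T, (K u).card ^ 2 = (T.sigma fun u => K u ×ˢ K u).card := by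
    simp [Finset.card_sigma, sq]
  rw [h1, sq, ← Finset.card_product]
  refine Finset.card_le_card_of_injOn
    -- The left operand of leaf `k` is paired with the right operand of leaf `k'` of the same tree.
    -- The pair reveals `i`, `k`, `k'`, `j` and the right-hand side.
    (fun x => (((x.1.1.1, x.2.1), x.1.2.fst), ((x.2.2 + 1, x.1.1.2), x.1.2.snd))) ?_ ?_
  · rintro ⟨u, k, k'⟩ hx
    simp only [Finset.coe_sigma, Set.mem_sigma_iff, Finset.mem_coe, Finset.mem_product] at hx
    exact Finset.mem_coe.2 (Finset.mem_product.2 ⟨hl u hx.1 k hx.2.1, hr u hx.1 k' hx.2.2⟩)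
  · rintro ⟨⟨⟨i, j⟩, r⟩, k, k'⟩ hx ⟨⟨⟨i', j'⟩, r'⟩, l, l'⟩ hy h
    simp only [Finset.coe_sigma, Set.mem_sigma_iff, Finset.mem_coe] at hx hy
    simp only [Prod.mk.injEq, add_left_inj] at h
    obtain ⟨⟨⟨rfl, rfl⟩, h2⟩, ⟨rfl, rfl⟩, h3⟩ := h
    obtain rfl : r = r' := hT _ hx.1 _ hy.1 h2 h3
    rfl

namespace CYKTrees

variable {α : Type*} {g : ContextFreeGrammar α} {n : ℕ} {τ : CYKTrees g n} {M : ℕ}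

/-- The distribution of the leaves over the segments bounds their number. -/
theorem sum_card_le_of_trace (hM : 1 ≤ M) (R : Trace τ.cdag M)
    (T : Finset ((ℕ × ℕ) × BinaryRule g.NT)) (K : (ℕ × ℕ) × BinaryRule g.NT → Finset ℕ)
    (hT1 : ∀ u ∈ T, 1 ≤ u.1.1 ∧ u.1.1 < u.1.2 ∧ u.1.2 ≤ n ∧ u.2 ∈ binaryRules g)
    (hT2 : ∀ u ∈ T, ∀ u' ∈ T, u.2.fst = u'.2.fst → u.2.snd = u'.2.snd → u.2 = u'.2)
    (hK : ∀ u ∈ T, ∀ k ∈ K u, u.1.1 + 2 * M ≤ k ∧ k + 1 + 2 * M ≤ u.1.2) :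
    ∃ h : ℕ, h * M ≤ (∑ t ∈ Finset.range R.length, R.cost t) + M ∧
      ∑ u ∈ T, ((K u).card : ℝ) ≤ h * (3 * M * √(M : ℝ)) + √(M : ℝ) * T.card := by
  classical
  obtain ⟨h, β, hβ0, hβh, hβm, hβ, hβM, hh⟩ := exists_segments M hM R.length R.cost R.cost_le
  refine ⟨h, hh, ?_⟩
  have hroot : ∀ u ∈ T, ∃ s < h, ∃ t, β s ≤ t ∧ t < β (s + 1) ∧
      .ruleNode u.1.1 u.1.2 u.2 [] ∈ R.cmp t := fun u hu => by
    obtain ⟨h1, h2, h3, h4⟩ := hT1 u hu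
    obtain ⟨t, ht, hC⟩ := R.complete (.ruleNode u.1.1 u.1.2 u.2 [])
      ⟨h1, h2, h3, h4, _, BTree.subtree_nil _⟩
    have hne : (.ruleNode u.1.1 u.1.2 u.2 []) ∉ τ.cdag.inputs := by
      rintro ⟨-, he⟩
      exact (τ.preds_ruleNode_nonempty (BTree.subtree_nil _)).ne_empty he
    obtain ⟨t', ht', hc, -, -⟩ := R.exists_cmp hne ht (Or.inl hC)
    obtain ⟨s, hs, hs1, hs2⟩ := exists_segment (h := h) hβ0 (t := t') (by omega)
    exact ⟨s, hs, t', hs1, hs2, hc⟩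
  have hroot' : ∀ u, ∃ s, u ∈ T → s < h ∧ ∃ t, β s ≤ t ∧ t < β (s + 1) ∧
      .ruleNode u.1.1 u.1.2 u.2 [] ∈ R.cmp t := fun u => by
    by_cases hu : u ∈ T
    · obtain ⟨s, hs⟩ := hroot u hu
      exact ⟨s, fun _ => hs⟩
    · exact ⟨0, fun h => absurd h hu⟩
  choose ρ hρ using hroot'
  -- Each leaf is charged to the segment of one useful evaluation, even if it is evaluated several
  -- times.
  have hleaf : ∀ u k, ∃ s, u ∈ T → k ∈ K u → s < h ∧
      R.Accessible (β s) (β (s + 1)) (τ.varRoot u.1.1 k u.2.fst) ∧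
      R.Accessible (β s) (β (s + 1)) (τ.varRoot (k + 1) u.1.2 u.2.snd) ∧
      (ρ u = s ∨ ∃ v ∈ R.kept (β s) (β (s + 1)), v.InRuleTree u.1.1 u.1.2 u.2) := fun u k => by
    by_cases hu : u ∈ T ∧ k ∈ K u
    · obtain ⟨h1, h2, h3, h4⟩ := hT1 u hu.1
      obtain ⟨h5, h6⟩ := hK u hu.1 k hu.2
      obtain ⟨hs, t, ht1, ht2, hc⟩ := hρ u hu.1
      obtain ⟨p, hp⟩ := BTree.exists_subtree_leaf
        (((τ.ruleTree_leaves u.1.1 u.1.2 h1 h2 h3 u.2 h4).2 k).2 ⟨by omega, by omega⟩)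
      obtain ⟨s, hs', x, hx1, hx2, hx3, huse⟩ :=
        exists_useful_cmp hβ0 hβh hβm hβ hs ht1 ht2 hc p _ hp
      have hpr : ∀ v ∈ τ.preds (.ruleNode u.1.1 u.1.2 u.2 p),
          R.Accessible (β s) (β (s + 1)) v := fun v hv =>
        ⟨x, hx1, hx2.le, (R.cmp_pred x (hx2.trans_le (hβ _)) _ hx3).2 v hv⟩
      rw [τ.preds_leaf hp] at hpr
      exact ⟨s, fun _ _ => ⟨hs', hpr _ (by simp), hpr _ (by simp), huse⟩⟩
    · exact ⟨0, fun h1 h2 => absurd ⟨h1, h2⟩ hu⟩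
  choose σ hσ using hleaf
  have hav : ∀ s, (R.avail (β s) (β (s + 1))).card ≤ 2 * M := fun s =>
    R.card_avail_le (hβ _) (hβM s)
  refine sum_card_le_of_segments T K σ ρ h M hM (fun u hu k hk => (hσ u k hu hk).1) ?_ ?_
  · intro s _
    refine (sum_card_sq_le T (fun u => (K u).filter fun k => σ u k = s)
      (touched R (β s) (β (s + 1))) hT2 ?_ ?_).trans
      (Nat.pow_le_pow_left (Finset.card_image_le.trans (hav s)) 2)
    · intro u hu k hk
      obtain ⟨hk', rfl⟩ := Finset.mem_filter.1 hk
      obtain ⟨h1, h2, h3, h4⟩ := hT1 u hu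
      obtain ⟨h5, h6⟩ := hK u hu k hk'
      have := hav (σ u k)
      exact mem_touched_of_card_le (hβ _) h1 (by omega) (hσ u k hu hk').2.1 (by omega)
    · intro u hu k hk
      obtain ⟨hk', rfl⟩ := Finset.mem_filter.1 hk
      obtain ⟨h1, h2, h3, h4⟩ := hT1 u hu
      obtain ⟨h5, h6⟩ := hK u hu k hk'
      have := hav (σ u k)
      exact mem_touched_of_card_le (hβ _) (by omega) h3 (hσ u k hu hk').2.2.1 (by omega)
  · intro s _
    set O := R.kept (β s) (β (s + 1))
    have hO : O.card ≤ 2 * M := R.card_kept_le (hβ _) (hβM s)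
    have hsub : (T.filter fun u => ∃ k ∈ K u, σ u k = s) ⊆
        (T.filter fun u => ∃ v ∈ O, v.InRuleTree u.1.1 u.1.2 u.2) ∪
          (T.filter fun u => ρ u = s) := fun u hu => by
      obtain ⟨hu', k, hk, rfl⟩ := Finset.mem_filter.1 hu
      rcases (hσ u k hu' hk).2.2.2 with h' | h'
      · exact Finset.mem_union_right _ (Finset.mem_filter.2 ⟨hu', h'⟩)
      · exact Finset.mem_union_left _ (Finset.mem_filter.2 ⟨hu', h'⟩)
    -- Distinct rule trees are disjoint, so a kept value accounts for only one of them.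
    have hcO : (T.filter fun u => ∃ v ∈ O, v.InRuleTree u.1.1 u.1.2 u.2).card ≤ O.card := by
      have hex : ∀ u ∈ T.filter fun u => ∃ v ∈ O, v.InRuleTree u.1.1 u.1.2 u.2,
          ∃ v, v ∈ O ∧ v.InRuleTree u.1.1 u.1.2 u.2 := fun u hu => (Finset.mem_filter.1 hu).2
      refine Finset.card_le_card_of_forall_subsingleton
        (fun u v => v.InRuleTree u.1.1 u.1.2 u.2) hex ?_
      rintro v - ⟨⟨i, j⟩, r⟩ ⟨-, p, hp⟩ ⟨⟨i', j'⟩, r'⟩ ⟨-, p', hp'⟩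
      subst hp
      simp only [CYKVertex.ruleNode.injEq] at hp'
      obtain ⟨rfl, rfl, rfl, -⟩ := hp'
      rfl
    have := (Finset.card_le_card hsub).trans (Finset.card_union_le _ _)
    omega

/-! ### The large subproblems and the explicit bound -/

theorem sum_range_sub_add_one (y : ℕ) :
    ∑ x ∈ Finset.range (y + 1), ((y + 1 - x : ℕ) : ℝ) = (y + 1) * (y + 2) / 2 := by
  induction y with
  | zero => simp
  | succ y ih =>
    rw [Finset.sum_range_succ']
    simp only [Nat.add_sub_add_right, ih]
    push_cast
    ring

/-- Only subproblems with `j - i > 4 * M` have splits with both sides large. For each right-hand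
side they form a triangular number of trees, with a tetrahedral number of such leaves. -/
theorem numRHS_mul_le (hM : 1 ≤ M) (R : Trace τ.cdag M) (N : ℕ) (hN : N + 4 * M + 1 ≤ n) :
    ∃ h : ℕ, h * M ≤ (∑ t ∈ Finset.range R.length, R.cost t) + M ∧
      (numRHS g : ℝ) * (N * (N + 1) * (N + 2) / 6) ≤
        h * (3 * M * √(M : ℝ)) + √(M : ℝ) * (numRHS g * (N * (N + 1) / 2)) := by
  classical
  obtain ⟨P, hP, hcard, hinj⟩ := exists_representatives g
  -- With `i = x + 1` and `j = y + 4 * M + 2` there are exactly `y + 1 - x` admissible `k`.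
  have hf : Function.Injective fun z : (_ : ℕ) × ℕ => (z.2 + 1, z.1 + 4 * M + 2) := by
    rintro ⟨y, x⟩ ⟨y', x'⟩ h
    simp only [Prod.mk.injEq, add_left_inj] at h
    obtain ⟨rfl, rfl⟩ := h
    rfl
  set I : Finset (ℕ × ℕ) :=
    ((Finset.range N).sigma fun y => Finset.range (y + 1)).map ⟨_, hf⟩ with hI
  have hmem : ∀ z ∈ I, 1 ≤ z.1 ∧ z.1 < z.2 ∧ z.2 ≤ n := fun z hz => by
    obtain ⟨⟨y, x⟩, h1, rfl⟩ := Finset.mem_map.1 hz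
    simp only [Finset.mem_sigma, Finset.mem_range] at h1
    simp only [Function.Embedding.coeFn_mk]
    omega
  obtain ⟨h, hh, hle⟩ := sum_card_le_of_trace hM R (I ×ˢ P)
    (fun u => Finset.Ico (u.1.1 + 2 * M) (u.1.2 - 2 * M)) (fun u hu => by
      obtain ⟨h1, h2⟩ := Finset.mem_product.1 hu
      obtain ⟨h3, h4, h5⟩ := hmem _ h1
      exact ⟨h3, h4, h5, hP _ h2⟩) (fun u hu u' hu' => by
      exact hinj _ (Finset.mem_product.1 hu).2 _ (Finset.mem_product.1 hu').2)
    (fun u hu k hk => by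
      have := Finset.mem_Ico.1 hk
      omega)
  refine ⟨h, hh, ?_⟩
  have e1 : ∑ u ∈ I ×ˢ P, ((Finset.Ico (u.1.1 + 2 * M) (u.1.2 - 2 * M)).card : ℝ)
      = numRHS g * (N * (N + 1) * (N + 2) / 6) := by
    rw [Finset.sum_product]
    simp only [Finset.sum_const, nsmul_eq_mul, hcard, ← Finset.mul_sum, Nat.card_Ico]
    congr 1
    rw [hI, Finset.sum_map, Finset.sum_sigma]
    have : ∀ y ∈ Finset.range N, ∑ x ∈ Finset.range (y + 1),
        ((y + 4 * M + 2 - 2 * M - (x + 1 + 2 * M) : ℕ) : ℝ)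
          = (y + 1) * (y + 2) / 2 := fun y _ => by
      rw [← sum_range_sub_add_one]
      refine Finset.sum_congr rfl fun x _ => ?_
      congr 1; omega
    simp only [Function.Embedding.coeFn_mk]
    rw [Finset.sum_congr rfl this]
    clear * -
    induction N with
    | zero => simp
    | succ N ih =>
      rw [Finset.sum_range_succ, ih]; push_cast; ring
  have e2 : ((I ×ˢ P).card : ℝ) = numRHS g * (N * (N + 1) / 2) := by
    rw [Finset.card_product, hcard, hI, Finset.card_map, Finset.card_sigma]
    push_cast
    rw [mul_comm]
    congr 1
    simp only [Finset.card_range]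
    clear * -
    induction N with
    | zero => simp
    | succ N ih =>
      rw [Finset.sum_range_succ, ih]; push_cast; ring
  rwa [e1, e2] at hle

/-- Every input is read: there is one for each position of the string. -/
theorem length_le_sum_cost (R : Trace τ.cdag M) :
    n ≤ ∑ t ∈ Finset.range R.length, R.cost t := by
  classical
  have hinj : Set.InjOn (fun i => CYKVertex.source i i g.initial) (Finset.Icc 1 n : Finset ℕ) :=
    fun i _ j _ h => by simpa using h
  have h := R.card_le_sum_cost
    ((Finset.Icc 1 n).image fun i => CYKVertex.source i i g.initial) (fun v hv => by
      obtain ⟨i, hi, rfl⟩ := Finset.mem_image.1 hv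
      obtain ⟨h1, h2⟩ := Finset.mem_Icc.1 hi
      exact ⟨⟨h1, le_rfl, h2, Or.inl rfl⟩, rfl⟩)
  rwa [Finset.card_image_of_injOn hinj, Nat.card_Icc, Nat.add_sub_cancel] at h

/-- The number of words moved. -/
theorem max_le_sum_cost (hM : 1 ≤ M) (R : Trace τ.cdag M) :
    max (((n : ℝ) - 6 * M - 1) ^ 3 / (18 * √(M : ℝ)) * numRHS g - 2 * M * numRHS g) (n : ℝ) ≤
      ((∑ t ∈ Finset.range R.length, R.cost t : ℕ) : ℝ) := by
  refine max_le ?_ (by exact_mod_cast length_le_sum_cost R)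
  have hM' : (1 : ℝ) ≤ M := by exact_mod_cast hM
  have hpos : (0 : ℝ) < √(M : ℝ) := Real.sqrt_pos.2 (by linarith)
  have hsqM : √(M : ℝ) * √(M : ℝ) = M := Real.mul_self_sqrt (by linarith)
  set q : ℕ := ∑ t ∈ Finset.range R.length, R.cost t with hq
  set Γ : ℕ := numRHS g with hΓ
  have hq0 : (0 : ℝ) ≤ q := Nat.cast_nonneg _
  have hΓ0 : (0 : ℝ) ≤ Γ := Nat.cast_nonneg _
  rcases Nat.lt_or_ge n (6 * M + 1) with hn | hn
  · have hn' : (n : ℝ) - 6 * M - 1 ≤ 0 := by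
      have : (n : ℝ) ≤ 6 * M + 1 := by exact_mod_cast hn.le
      linarith
    have h1 : ((n : ℝ) - 6 * M - 1) ^ 3 ≤ 0 := Odd.pow_nonpos (by decide) hn'
    have h2 : ((n : ℝ) - 6 * M - 1) ^ 3 / (18 * √(M : ℝ)) * Γ ≤ 0 :=
      mul_nonpos_of_nonpos_of_nonneg (div_nonpos_of_nonpos_of_nonneg h1 (by positivity)) hΓ0
    have h3 : (0 : ℝ) ≤ 2 * M * Γ := by positivity
    linarith
  rcases Nat.eq_zero_or_pos Γ with h0 | h0
  · simp [h0]
  have hΓ1 : (1 : ℝ) ≤ Γ := by exact_mod_cast h0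
  obtain ⟨m, rfl⟩ := Nat.exists_eq_add_of_le hn
  -- This is the largest admissible `N`, namely `n - 4 * M - 1`. Its excess `2 * M` over `m` absorbs
  -- the loss `3 * √M` from the tree count, as `2 * M + 2 ≥ 3 * √M`.
  obtain ⟨h, hh, hle⟩ := numRHS_mul_le hM R (m + 2 * M) (by omega)
  have hm : ((6 * M + 1 + m : ℕ) : ℝ) - 6 * M - 1 = m := by push_cast; ring
  rw [hm]
  have hm0 : (0 : ℝ) ≤ m := Nat.cast_nonneg _
  have hh' : (h : ℝ) * M ≤ q + M := by exact_mod_cast hh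
  have h1 : (h : ℝ) * (3 * M * √(M : ℝ)) ≤ 3 * √(M : ℝ) * (q + M) := by
    have := mul_le_mul_of_nonneg_left hh' (show 0 ≤ 3 * √(M : ℝ) by positivity)
    linarith
  set N : ℝ := ((m + 2 * M : ℕ) : ℝ) with hN
  have hNm : N = m + 2 * M := by rw [hN]; push_cast; ring
  have h2 : (m : ℝ) ≤ N + 2 - 3 * √(M : ℝ) := by
    rw [hNm]; nlinarith [sq_nonneg (4 * √(M : ℝ) - 3)]
  have hmN : (m : ℝ) ≤ N := by rw [hNm]; linarith
  have h3 : (m : ℝ) ^ 3 ≤ N * (N + 1) * (N + 2 - 3 * √(M : ℝ)) := by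
    have : (m : ℝ) * m ≤ N * (N + 1) := mul_le_mul hmN (by linarith) hm0 (by linarith)
    calc (m : ℝ) ^ 3 = m * m * m := by ring
      _ ≤ _ := mul_le_mul this h2 hm0 (by positivity)
  have h4 : (Γ : ℝ) * m ^ 3 ≤ 18 * √(M : ℝ) * (q + M) := by
    have := mul_le_mul_of_nonneg_left h3 hΓ0
    linarith
  have h5 : (m : ℝ) ^ 3 / (18 * √(M : ℝ)) * Γ ≤ q + M := by
    rw [div_mul_eq_mul_div, div_le_iff₀ (by positivity)]
    linarith
  -- The last, possibly incomplete, segment costs an additive `M`, which `2 * M * Γ` covers since `Γ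
  -- ≥ 1`.
  have h6 : (M : ℝ) * 1 ≤ M * Γ := by gcongr
  linarith

end CYKTrees

/-- Since `1 ≤ M ≤ n / 100`, the base of the cube is at least `9 / 10 * n`. The main term then has
coefficient at least `0.729 / 18 > 0.04`, and the subtracted term takes away at most `0.01`. -/
theorem div_le_of_max_le {n M Γ q : ℝ} (hM : 1 ≤ M) (hΓ : 0 ≤ Γ) (hc : M ≤ 1 / 100 * n)
    (h : (n - 6 * M - 1) ^ 3 / (18 * √M) * Γ - 2 * M * Γ ≤ q) :
    1 / 100 * (n ^ 3 * Γ / √M) ≤ q := by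
  have hn : 100 ≤ n := by linarith
  have hpos : 0 < √M := Real.sqrt_pos.2 (by linarith)
  have hsq : √M ≤ n / 100 := by
    have : √M ≤ M := (Real.sqrt_le_left (by linarith)).2 (by nlinarith)
    linarith
  have h1 : (9 / 10 * n) ^ 3 ≤ (n - 6 * M - 1) ^ 3 := by
    apply pow_le_pow_left₀ <;> linarith
  have h2 : 2 * M * √M ≤ 1 / 100 * n ^ 3 := by
    have : M * √M ≤ (n / 100) * (n / 100) := by
      apply mul_le_mul <;> linarith
    nlinarith [pow_pos (show 0 < n by linarith) 2]
  have h3 : 1 / 100 * n ^ 3 ≤ (n - 6 * M - 1) ^ 3 / 18 - 2 * M * √M := by nlinarith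
  have h4 := mul_le_mul_of_nonneg_right h3 (show 0 ≤ Γ / √M by positivity)
  refine le_trans (le_of_eq (by ring)) (h4.trans (le_trans (le_of_eq ?_) h))
  field_simp

theorem theorem4 :
    ∃ c K : ℝ, 0 < c ∧ 0 < K ∧
      ∀ (α : Type*) [Finite α] (g : ContextFreeGrammar α) [Finite g.NT], IsCNF g →
        ∀ (w : List α) (τ : CYKTrees g w.length) (M B : ℕ), 1 ≤ M → 1 ≤ B →
          ∀ C : Schedule τ.cdag M B,
            max (((w.length : ℝ) - 6 * M - 1) ^ 3 / (18 * √(M : ℝ)) * numRHS g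
                - 2 * M * numRHS g) (w.length : ℝ) / B ≤ C.ioCount ∧
            ((M : ℝ) ≤ c * w.length →
              K * ((w.length : ℝ) ^ 3 * numRHS g / (√(M : ℝ) * B)) ≤ C.ioCount) := by
  refine ⟨1 / 100, 1 / 100, by norm_num, by norm_num, ?_⟩
  intro α _ g _ _ w τ M B hM hB C
  obtain ⟨C', hC'⟩ := C.exists_refinement hB
  obtain ⟨R, hR⟩ := C'.exists_trace
  have h := CYKTrees.max_le_sum_cost hM R
  rw [hR, hC', Nat.cast_mul] at h
  have hB' : (0 : ℝ) < B := by exact_mod_cast hB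
  refine ⟨by rwa [div_le_iff₀ hB', mul_comm (C.ioCount : ℝ)], fun hc => ?_⟩
  have h1 := div_le_of_max_le (by exact_mod_cast hM) (Nat.cast_nonneg _) hc
    ((le_max_left _ _).trans h)
  rw [← div_div, ← mul_div_assoc, div_le_iff₀ hB', mul_comm (C.ioCount : ℝ)]
  exact h1
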